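/- Let $X$ be the graph with vertex set $\mathbb{Z}^2$ in which two vertices are adjacent exactly when their $\ell_1$-distance is $1$. For $A\subseteq\mathbb{Z}^2$ let $\partial A$ be the set of vertices not in $A$ that are adjacent to some vertex of $A$. A finite set $A\subset\mathbb{Z}^2$ is called minimal if $|\partial A|\le|\partial B|$ for every $B\subset\mathbb{Z}^2$ with $|B|=|A|$. Two subsets of $\mathbb{Z}^2$ are congruent if some graph automorphism of $X$ maps one onto the other. A set $A$ is connected if any two of its vertices are joined by a path of $X$ contained in $A$ (so the empty set is connected). Let $B(0,2)=\{(x,y)\in\mathbb{Z}^2 : 0\le y-x\le 0,\ 0\le y+x\le 2\}=\{(0,0),(1,1)\}$. A cone is a subset of $\mathbb{Z}^2$ congruent to $\{(x,y)\in\mathbb{Z}^2 : y-x\ge 0,\ y+x\ge 0\}$. Let $A\subset\mathbb{Z}^2$ be a minimal set. Then $A$ is connected if and only if $A$ is not congruent to $B(0,2)$. Moreover, the complement $\mathbb{Z}^2\setminus A$ is a union of cones. -/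

import Mathlib

namespace L1Lattice

/-- The graph `X` on the vertex set `ℤ²`: two vertices are adjacent iff their `ℓ¹`-distance is one. -/
def X : SimpleGraph (ℤ × ℤ) where
  Adj u v := |u.1 - v.1| + |u.2 - v.2| = 1
  symm := ⟨fun u v h => by rw [abs_sub_comm v.1, abs_sub_comm v.2]; exact h⟩
  loopless := ⟨fun u h => by simp at h⟩

/-- The vertex boundary of a set of vertices of a graph. -/
def vertexBoundary {V : Type*} (G : SimpleGraph V) (A : Set V) : Set V :=
  {u | u ∉ A ∧ ∃ v ∈ A, G.Adj u v}

/-- A finite set of vertices is minimal if its vertex boundary is smallest possible among all sets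
with the same number of vertices. -/
def IsMinimal {V : Type*} (G : SimpleGraph V) (A : Set V) : Prop :=
  A.Finite ∧ ∀ B : Set V, B.encard = A.encard →
    (vertexBoundary G A).encard ≤ (vertexBoundary G B).encard

/-- Two sets of vertices are congruent if a graph automorphism maps one onto the other. -/
def Congruent {V : Type*} (G : SimpleGraph V) (A B : Set V) : Prop :=
  ∃ φ : G ≃g G, φ '' A = B

/-- A set of vertices is connected if any two of its points are joined by a path inside it, that is,
if its induced subgraph is connected (the empty set counts as connected). -/
def IsConnectedSet {V : Type*} (G : SimpleGraph V) (A : Set V) : Prop :=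
  (G.induce A).Preconnected

/-- The box `B(α, β)`. -/
def box (α β : ℕ) : Set (ℤ × ℤ) :=
  {p | (0 ≤ p.2 - p.1 ∧ p.2 - p.1 ≤ α) ∧ (0 ≤ p.2 + p.1 ∧ p.2 + p.1 ≤ β)}

/-- The cone above the origin. -/
def standardCone : Set (ℤ × ℤ) := {p | 0 ≤ p.2 - p.1 ∧ 0 ≤ p.2 + p.1}

/-- A cone is a set congruent to the standard cone. -/
def IsCone (C : Set (ℤ × ℤ)) : Prop := Congruent X C standardCone

/-- A set is a union of cones (the empty union is allowed). -/
def IsUnionOfCones (S : Set (ℤ × ℤ)) : Prop :=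
  ∃ 𝒞 : Set (Set (ℤ × ℤ)), (∀ C ∈ 𝒞, IsCone C) ∧ S = ⋃₀ 𝒞

end L1Lattice

/-! In diagonal coordinates each parity class of the lattice is a copy of the integer grid, and the
neighbours of a vertex form a 2 × 2 block of the other class. If `A` has even cells `S` and odd
cells `T`, then |∂A| ≥ |S + Q| + |T + Q| - |S| - |T| with Q = {0,1}². A nonempty `S` satisfies |S +
Q| ≥ |S| + k + 1, where k is its number of occupied rows and columns (`card_thicken`). With l the
same count for `T`, this gives |∂A| ≥ k + l + 2 when both classes are nonempty.

Near-square boxes show that a minimal set with |∂A| ≥ K + 3 and K ≥ 2 satisfies K² + 7 ≤ 8|A|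
(`sq_le_card_of_minimal`). Since 4|S| ≤ k² and 4|T| ≤ l², this forces equality in the lower bound
(`boundaryCard_of_minimal`). Equality makes both classes orthogonally convex and gives every vertex
of `A` a neighbour in `A` (`linked_of_minimal`). A vertex outside `A` then has a closed diagonal
quadrant free of `A`, that is, a cone in the complement.

If such an `A` were disconnected, common neighbours would keep each row and column of a class within
one component. Each class would split into two parts sharing no row or column, making `A` too small
for its boundary (`no_split`). When only one class is occupied, the same estimates leave a single
point or a diagonal pair; the pair is the exception congruent to B(0,2). -/

namespace L1Lattice

/-! ### Thickening finite subsets of the square grid -/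

/-- The union of `S` with its translate by `(1, 0)`. -/
def thickenRight (S : Finset (ℤ × ℤ)) : Finset (ℤ × ℤ) :=
  S ∪ S.image fun p => (p.1 + 1, p.2)

/-- The union of `S` with its translate by `(0, 1)`. -/
def thickenUp (S : Finset (ℤ × ℤ)) : Finset (ℤ × ℤ) :=
  S ∪ S.image fun p => (p.1, p.2 + 1)

/-- The sumset of `S` with `{0, 1} × {0, 1}`. -/
def thicken (S : Finset (ℤ × ℤ)) : Finset (ℤ × ℤ) :=
  thickenUp (thickenRight S)

/-- The number of occupied rows plus the number of occupied columns. -/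
def lineCount (S : Finset (ℤ × ℤ)) : ℕ :=
  (S.image Prod.fst).card + (S.image Prod.snd).card

theorem mem_thickenRight {S : Finset (ℤ × ℤ)} {i j : ℤ} :
    (i, j) ∈ thickenRight S ↔ (i, j) ∈ S ∨ (i - 1, j) ∈ S := by
  simp only [thickenRight, Finset.mem_union, Finset.mem_image, Prod.mk.injEq, Prod.exists]
  refine or_congr_right ⟨?_, fun h => ⟨_, _, h, by omega, rfl⟩⟩
  rintro ⟨a, b, h, rfl, rfl⟩
  simpa using h

theorem mem_thickenUp {S : Finset (ℤ × ℤ)} {i j : ℤ} :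
    (i, j) ∈ thickenUp S ↔ (i, j) ∈ S ∨ (i, j - 1) ∈ S := by
  simp only [thickenUp, Finset.mem_union, Finset.mem_image, Prod.mk.injEq, Prod.exists]
  refine or_congr_right ⟨?_, fun h => ⟨_, _, h, rfl, by omega⟩⟩
  rintro ⟨a, b, h, rfl, rfl⟩
  simpa using h

theorem mem_thicken {S : Finset (ℤ × ℤ)} {i j : ℤ} :
    (i, j) ∈ thicken S ↔
      ((i, j) ∈ S ∨ (i - 1, j) ∈ S) ∨ ((i, j - 1) ∈ S ∨ (i - 1, j - 1) ∈ S) := by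
  simp only [thicken, mem_thickenUp, mem_thickenRight]

theorem mem_image_swap {S : Finset (ℤ × ℤ)} {i j : ℤ} :
    (i, j) ∈ S.image Prod.swap ↔ (j, i) ∈ S := by
  simp [Prod.ext_iff]

theorem card_image_swap (S : Finset (ℤ × ℤ)) : (S.image Prod.swap).card = S.card :=
  Finset.card_image_of_injective _ Prod.swap_injective

theorem lineCount_swap (S : Finset (ℤ × ℤ)) : lineCount (S.image Prod.swap) = lineCount S := by
  simp only [lineCount, Finset.image_image]
  exact Nat.add_comm _ _

theorem thicken_swap (S : Finset (ℤ × ℤ)) :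
    thicken (S.image Prod.swap) = (thicken S).image Prod.swap := by
  ext ⟨i, j⟩
  simp only [mem_thicken, mem_image_swap]
  tauto

theorem thickenUp_swap (S : Finset (ℤ × ℤ)) :
    thickenRight (S.image Prod.swap) = (thickenUp S).image Prod.swap := by
  ext ⟨i, j⟩
  simp only [mem_thickenUp, mem_thickenRight, mem_image_swap]

theorem exists_row_max {S : Finset (ℤ × ℤ)} {i j : ℤ} (h : (i, j) ∈ S) (P : ℤ → Prop)
    (hP : P i) : ∃ m, i ≤ m ∧ P m ∧ (m, j) ∈ S ∧ ∀ m', P m' → (m', j) ∈ S → m' ≤ m := by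
  classical
  let T := (S.image Prod.fst).filter fun m => P m ∧ (m, j) ∈ S
  have hi : i ∈ T := by
    simp only [T, Finset.mem_filter, Finset.mem_image]
    exact ⟨⟨_, h, rfl⟩, hP, h⟩
  have hmax := T.max'_mem ⟨i, hi⟩
  have h2 := (Finset.mem_filter.1 hmax).2
  refine ⟨T.max' ⟨i, hi⟩, T.le_max' _ hi, h2.1, h2.2, fun m' hm hm' => T.le_max' _ ?_⟩
  simp only [T, Finset.mem_filter, Finset.mem_image]
  exact ⟨⟨_, hm', rfl⟩, hm, hm'⟩

/-- The translate of the rightmost point of a row is always new, so every occupied row gains a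
point. -/
theorem thickenRight_sdiff_snd (S : Finset (ℤ × ℤ)) :
    (thickenRight S \ S).image Prod.snd = S.image Prod.snd := by
  ext j
  simp only [Finset.mem_image, Finset.mem_sdiff, Prod.exists, exists_eq_right]
  constructor
  · rintro ⟨i, h, -⟩
    rcases mem_thickenRight.1 h with h | h
    exacts [⟨_, h⟩, ⟨_, h⟩]
  · rintro ⟨i, h⟩
    obtain ⟨m, -, -, hm, hmax⟩ := exists_row_max h (fun _ => True) trivial
    refine ⟨m + 1, mem_thickenRight.2 (Or.inr (by simpa using hm)), fun h' => ?_⟩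
    have := hmax _ trivial h'
    omega

theorem subset_thickenRight (S : Finset (ℤ × ℤ)) : S ⊆ thickenRight S :=
  Finset.subset_union_left

theorem card_thickenRight (S : Finset (ℤ × ℤ)) :
    S.card + (S.image Prod.snd).card ≤ (thickenRight S).card := by
  have h1 := Finset.card_sdiff_add_card_eq_card (subset_thickenRight S)
  have h2 := Finset.card_image_le (s := thickenRight S \ S) (f := Prod.snd)
  rw [thickenRight_sdiff_snd] at h2
  omega

/-- In the equality case each row gains exactly one point. A gap would yield two: one after the last
point before the gap, one after the end of the row. -/
theorem row_convex_of_card_thickenRight {S : Finset (ℤ × ℤ)}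
    (h : (thickenRight S).card ≤ S.card + (S.image Prod.snd).card) {i i' m j : ℤ}
    (hi : (i, j) ∈ S) (hi' : (i', j) ∈ S) (him : i ≤ m) (hmi : m ≤ i') : (m, j) ∈ S := by
  by_contra hm
  have h1 := Finset.card_sdiff_add_card_eq_card (subset_thickenRight S)
  have hinj : Set.InjOn Prod.snd (↑(thickenRight S \ S) : Set (ℤ × ℤ)) := by
    rw [← Finset.card_image_iff]
    refine le_antisymm Finset.card_image_le ?_
    rw [thickenRight_sdiff_snd]
    omega
  obtain ⟨p, hip, hpm, hp, hpmax⟩ := exists_row_max hi (fun x => x ≤ m) him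
  obtain ⟨q, hiq, -, hq, hqmax⟩ := exists_row_max hi' (fun _ => True) trivial
  have hp' : (p + 1, j) ∈ thickenRight S \ S := by
    refine Finset.mem_sdiff.2 ⟨mem_thickenRight.2 (Or.inr (by simpa using hp)), fun h' => ?_⟩
    rcases eq_or_ne p m with rfl | hne
    · exact hm hp
    · have := hpmax (p + 1) (by omega) h'
      omega
  have hq' : (q + 1, j) ∈ thickenRight S \ S := by
    refine Finset.mem_sdiff.2 ⟨mem_thickenRight.2 (Or.inr (by simpa using hq)), fun h' => ?_⟩
    have := hqmax (q + 1) trivial h'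
    omega
  have heq := hinj hp' hq' rfl
  simp only [Prod.mk.injEq] at heq
  have : q ≤ m := by omega
  have : q = m := by omega
  exact hm (this ▸ hq)

theorem card_thickenUp (S : Finset (ℤ × ℤ)) :
    S.card + (S.image Prod.fst).card ≤ (thickenUp S).card := by
  have := card_thickenRight (S.image Prod.swap)
  rw [thickenUp_swap, card_image_swap, card_image_swap, Finset.image_image] at this
  exact this

theorem col_convex_of_card_thickenUp {S : Finset (ℤ × ℤ)}
    (h : (thickenUp S).card ≤ S.card + (S.image Prod.fst).card) {i j j' m : ℤ}
    (hj : (i, j) ∈ S) (hj' : (i, j') ∈ S) (hjm : j ≤ m) (hmj : m ≤ j') : (i, m) ∈ S := by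
  have key : (thickenRight (S.image Prod.swap)).card ≤
      (S.image Prod.swap).card + ((S.image Prod.swap).image Prod.snd).card := by
    rw [thickenUp_swap, card_image_swap, card_image_swap, Finset.image_image]
    exact h
  exact mem_image_swap.1 (row_convex_of_card_thickenRight key (mem_image_swap.2 hj)
    (mem_image_swap.2 hj') hjm hmj)

/-- The projection of `S` to the first coordinate, as a subset of a line in the plane. -/
def columnShadow (S : Finset (ℤ × ℤ)) : Finset (ℤ × ℤ) := S.image fun p => (p.1, 0)

theorem mem_columnShadow {S : Finset (ℤ × ℤ)} {i : ℤ} :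
    (i, 0) ∈ columnShadow S ↔ ∃ j, (i, j) ∈ S := by
  simp [columnShadow]

theorem card_columnShadow (S : Finset (ℤ × ℤ)) :
    (columnShadow S).card = (S.image Prod.fst).card := by
  have : columnShadow S = (S.image Prod.fst).image fun i => (i, 0) := by
    simp [columnShadow, Finset.image_image, Function.comp_def]
  rw [this]
  exact Finset.card_image_of_injective _ fun a b h => (Prod.mk.inj h).1

theorem columnShadow_thickenRight (S : Finset (ℤ × ℤ)) :
    columnShadow (thickenRight S) = thickenRight (columnShadow S) := by
  simp [columnShadow, thickenRight, Finset.image_union, Finset.image_image, Function.comp_def]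

theorem card_columnShadow_snd {S : Finset (ℤ × ℤ)} (hS : S.Nonempty) :
    ((columnShadow S).image Prod.snd).card = 1 := by
  have : (columnShadow S).image Prod.snd = {0} := by
    simp only [columnShadow, Finset.image_image, Function.comp_def]
    exact Finset.image_const hS 0
  rw [this, Finset.card_singleton]

/-- The row bound applied to the shadow, which occupies a single row. This extra column is the
source of the `+ 1` in `card_thicken`. -/
theorem card_fst_thickenRight {S : Finset (ℤ × ℤ)} (hS : S.Nonempty) :
    (S.image Prod.fst).card + 1 ≤ ((thickenRight S).image Prod.fst).card := by
  have := card_thickenRight (columnShadow S)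
  rwa [card_columnShadow_snd hS, ← columnShadow_thickenRight, card_columnShadow,
    card_columnShadow] at this

theorem card_thicken {S : Finset (ℤ × ℤ)} (hS : S.Nonempty) :
    S.card + lineCount S + 1 ≤ (thicken S).card := by
  have h1 := card_thickenRight S
  have h2 := card_thickenUp (thickenRight S)
  have h3 := card_fst_thickenRight hS
  simp only [thicken, lineCount]
  omega

/-! ### Sets meeting the thickening bound are orthogonally convex -/

/-- Orthogonal convexity: a point all of whose four closed quadrants meet `S` lies in `S`. -/
def QuadrantConvex (S : ℤ → ℤ → Prop) : Prop :=
  ∀ z w, (∃ i j, S i j ∧ z ≤ i ∧ w ≤ j) → (∃ i j, S i j ∧ z ≤ i ∧ j ≤ w) →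
    (∃ i j, S i j ∧ i ≤ z ∧ w ≤ j) → (∃ i j, S i j ∧ i ≤ z ∧ j ≤ w) → S z w

/-- Rows are convex, unions of neighbouring columns are convex and the set of occupied columns
is convex. -/
structure ThickConvex (S : ℤ → ℤ → Prop) : Prop where
  row : ∀ ⦃i i' m j⦄, S i j → S i' j → i ≤ m → m ≤ i' → S m j
  adj : ∀ ⦃i i' j j' m⦄, S i j → S i' j' → i ≤ i' + 1 → i' ≤ i + 1 → j ≤ m → m ≤ j' →
    S i m ∨ S i' m
  col : ∀ ⦃i i' j j' m⦄, S i j → S i' j' → i ≤ m → m ≤ i' → ∃ l, S m l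

theorem thickConvex_of_card_thicken {S : Finset (ℤ × ℤ)}
    (h : (thicken S).card ≤ S.card + lineCount S + 1) :
    ThickConvex fun i j => (i, j) ∈ S := by
  rcases S.eq_empty_or_nonempty with rfl | hS
  · constructor <;> simp
  have h1 := card_thickenRight S
  have h2 := card_thickenUp (thickenRight S)
  have h3 := card_fst_thickenRight hS
  simp only [thicken, lineCount] at h
  have hrow : ∀ ⦃i i' m j : ℤ⦄, (i, j) ∈ S → (i', j) ∈ S → i ≤ m → m ≤ i' → (m, j) ∈ S :=
    fun _ _ _ _ => row_convex_of_card_thickenRight (by omega)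
  have hcol : ∀ {i j j' m : ℤ}, (i, j) ∈ thickenRight S → (i, j') ∈ thickenRight S →
      j ≤ m → m ≤ j' → (i, m) ∈ S ∨ (i - 1, m) ∈ S := fun a b c d =>
    mem_thickenRight.1 (col_convex_of_card_thickenUp (by omega) a b c d)
  refine ⟨hrow, ?_, ?_⟩
  · intro i i' j j' m hi hi' h12 h21 hj hj'
    have hself : ∀ {i j : ℤ}, (i, j) ∈ S → (i, j) ∈ thickenRight S := fun h =>
      mem_thickenRight.2 (Or.inl h)
    have hnext : ∀ {i i' j : ℤ}, (i, j) ∈ S → i = i' - 1 → (i', j) ∈ thickenRight S :=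
      fun h e => mem_thickenRight.2 (Or.inr (e ▸ h))
    rcases lt_trichotomy i i' with hlt | rfl | hlt
    · rcases hcol (hnext hi (by omega)) (hself hi') hj hj' with h | h
      · exact Or.inr h
      · exact Or.inl (by rwa [show i = i' - 1 by omega])
    · left
      rcases hcol (hself hi) (hself hi') hj hj' with h | h
      · exact h
      -- Column `i` is also part of column `i + 1` of the thickening. If `(i, m)` were missing, both
      -- `(i - 1, m)` and `(i + 1, m)` would be present, and row convexity fills the gap.
      rcases hcol (hnext hi (i' := i + 1) (by omega)) (hnext hi' (by omega)) hj hj' with h' | h'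
      · exact hrow h h' (by omega) (by omega)
      · simpa using h'
    · rcases hcol (hself hi) (hnext hi' (by omega)) hj hj' with h | h
      · exact Or.inl h
      · exact Or.inr (by rwa [show i' = i - 1 by omega])
  · intro i i' j j' m hi hi' h1' h2'
    refine mem_columnShadow.1 (row_convex_of_card_thickenRight ?_ (mem_columnShadow.2 ⟨_, hi⟩)
      (mem_columnShadow.2 ⟨_, hi'⟩) h1' h2')
    rw [card_columnShadow_snd hS, ← columnShadow_thickenRight, card_columnShadow,
      card_columnShadow]
    omega

namespace ThickConvex

variable {S : ℤ → ℤ → Prop}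

theorem neg_fst (h : ThickConvex S) : ThickConvex fun i j => S (-i) j where
  row _ _ _ _ hi hi' h1 h2 := h.row hi' hi (by omega) (by omega)
  adj _ _ _ _ _ hi hi' h1 h2 h3 h4 := h.adj hi hi' (by omega) (by omega) h3 h4
  col _ _ _ _ _ hi hi' h1 h2 := h.col hi' hi (by omega) (by omega)

theorem neg_snd (h : ThickConvex S) : ThickConvex fun i j => S i (-j) where
  row _ _ _ _ hi hi' h1 h2 := h.row hi hi' h1 h2
  adj _ _ _ _ _ hi hi' h1 h2 h3 h4 := (h.adj hi' hi h2 h1 (by omega) (by omega)).symm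
  col _ _ _ _ _ hi hi' h1 h2 := (h.col hi hi' h1 h2).imp' Neg.neg fun l hl => by simpa using hl

/-- Walk through the occupied columns from `i` to `z`. If row `w` is avoided, `adj` prevents
neighbouring columns from lying on opposite sides of it, so the walk stays below `w`, against the
point `(z, j₀)`. -/
theorem exists_left (h : ThickConvex S) {z w j₀ : ℤ} (h₀ : S z j₀) (hj₀ : w ≤ j₀)
    (hl : ∃ i j, S i j ∧ i ≤ z ∧ j ≤ w) : ∃ i ≤ z, S i w := by
  obtain ⟨i, j, hij, hiz, hjw⟩ := hl
  by_contra! hno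
  have key : ∀ t, i ≤ t → t ≤ z → ∃ j ≤ w, S t j := by
    intro t ht
    induction t, ht using Int.leInduction with
    | base => exact fun _ => ⟨j, hjw, hij⟩
    | succ t ht ih =>
      intro htz
      obtain ⟨j₁, hj₁, hs⟩ := ih (by omega)
      obtain ⟨j₂, hs₂⟩ := h.col hij h₀ (m := t + 1) (by omega) htz
      by_cases hj₂ : j₂ ≤ w
      · exact ⟨j₂, hj₂, hs₂⟩
      · rcases h.adj hs hs₂ (by omega) (by omega) hj₁ (by omega) with h' | h'
        exacts [absurd h' (hno _ (by omega)), absurd h' (hno _ (by omega))]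
  obtain ⟨j₁, hj₁, hs⟩ := key z hiz le_rfl
  rcases h.adj hs h₀ (by omega) (by omega) hj₁ hj₀ with h' | h' <;> exact hno _ le_rfl h'

theorem mem_of_above (h : ThickConvex S) {z w j₀ : ℤ} (h₀ : S z j₀) (hj₀ : w ≤ j₀)
    (hl : ∃ i j, S i j ∧ i ≤ z ∧ j ≤ w) (hr : ∃ i j, S i j ∧ z ≤ i ∧ j ≤ w) : S z w := by
  obtain ⟨i, hi, hs⟩ := h.exists_left h₀ hj₀ hl
  obtain ⟨i', hi', hs'⟩ := h.neg_fst.exists_left (z := -z) (w := w) (j₀ := j₀) (by simpa using h₀)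
    hj₀ (by
      obtain ⟨i, j, h1, h2, h3⟩ := hr
      exact ⟨-i, j, by simpa using h1, by omega, h3⟩)
  exact h.row hs hs' hi (by omega)

theorem quadrantConvex (h : ThickConvex S) : QuadrantConvex S := by
  intro z w hur hlr hul hll
  obtain ⟨j₀, h₀⟩ : ∃ j, S z j := by
    obtain ⟨i, j, h1, h2, -⟩ := hur
    obtain ⟨i', j', h1', h2', -⟩ := hll
    exact h.col h1' h1 h2' h2
  rcases le_total w j₀ with hw | hw
  · exact h.mem_of_above h₀ hw hll hlr
  · have flip : ∀ {P : ℤ → Prop}, (∃ i j, S i j ∧ P i ∧ w ≤ j) →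
        ∃ i j, S i (-j) ∧ P i ∧ j ≤ -w := by
      rintro P ⟨i, j, h1, h2, h3⟩
      exact ⟨i, -j, by simpa using h1, h2, by omega⟩
    have := h.neg_snd.mem_of_above (z := z) (w := -w) (j₀ := -j₀) (by simpa using h₀) (by omega)
      (flip hul) (flip hur)
    simpa using this

end ThickConvex

/-- Orthogonally convex sets whose occupied rows and columns are consecutive. -/
structure OrthoConvex (S : ℤ → ℤ → Prop) : Prop where
  quadrant : QuadrantConvex S
  fst : ∀ ⦃i i' j j' m⦄, S i j → S i' j' → i ≤ m → m ≤ i' → ∃ l, S m l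
  snd : ∀ ⦃i i' j j' m⦄, S i j → S i' j' → j ≤ m → m ≤ j' → ∃ l, S l m

theorem orthoConvex_of_card_thicken {S : Finset (ℤ × ℤ)}
    (h : (thicken S).card ≤ S.card + lineCount S + 1) :
    OrthoConvex fun i j => (i, j) ∈ S := by
  have h1 := thickConvex_of_card_thicken h
  have h2 := thickConvex_of_card_thicken (S := S.image Prod.swap) (by
    rwa [thicken_swap, card_image_swap, card_image_swap, lineCount_swap])
  refine ⟨h1.quadrantConvex, h1.col, fun i i' j j' m hi hi' hj hj' => ?_⟩
  obtain ⟨l, hl⟩ := h2.col (mem_image_swap.2 hi) (mem_image_swap.2 hi') hj hj'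
  exact ⟨l, mem_image_swap.1 hl⟩

/-! ### The two parity classes of the lattice -/

/-- Coordinates on the even sublattice along the diagonals. -/
def evenCell (p : ℤ × ℤ) : ℤ × ℤ := (p.2 - p.1, p.1 + p.2)

/-- Coordinates on the odd sublattice along the diagonals. -/
def oddCell (p : ℤ × ℤ) : ℤ × ℤ := (p.2 - p.1, p.1 + p.2 + 1)

theorem evenCell_injective : Function.Injective evenCell := by
  rintro ⟨a, b⟩ ⟨c, d⟩ h
  simp only [evenCell, Prod.mk.injEq] at h ⊢
  omega

theorem oddCell_injective : Function.Injective oddCell := by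
  rintro ⟨a, b⟩ ⟨c, d⟩ h
  simp only [oddCell, Prod.mk.injEq] at h ⊢
  omega

theorem evenCell_ne_oddCell (p q : ℤ × ℤ) : evenCell p ≠ oddCell q := by
  intro h
  simp only [evenCell, oddCell, Prod.mk.injEq] at h
  omega

theorem exists_cell (p : ℤ × ℤ) :
    (∃ i j, p = evenCell (i, j)) ∨ ∃ i j, p = oddCell (i, j) := by
  obtain ⟨x, y⟩ := p
  simp only [evenCell, oddCell, Prod.mk.injEq]
  rcases Int.even_or_odd' (x + y) with ⟨k, hk | hk⟩
  · exact Or.inl ⟨k - x, k, by omega, by omega⟩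
  · exact Or.inr ⟨k - x, k, by omega, by omega⟩

theorem adj_iff {u v : ℤ × ℤ} : X.Adj u v ↔
    (u.1 = v.1 ∧ (u.2 = v.2 + 1 ∨ v.2 = u.2 + 1)) ∨
      (u.2 = v.2 ∧ (u.1 = v.1 + 1 ∨ v.1 = u.1 + 1)) := by
  change |u.1 - v.1| + |u.2 - v.2| = 1 ↔ _
  rcases abs_cases (u.1 - v.1) with h | h <;> rcases abs_cases (u.2 - v.2) with h' | h' <;> omega

theorem adj_evenCell_oddCell {i j k l : ℤ} :
    X.Adj (evenCell (i, j)) (oddCell (k, l)) ↔ (k = i ∨ k = i - 1) ∧ (l = j ∨ l = j - 1) := by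
  rw [adj_iff]
  simp only [evenCell, oddCell]
  omega

theorem not_adj_evenCell (p q : ℤ × ℤ) : ¬ X.Adj (evenCell p) (evenCell q) := by
  rw [adj_iff]
  simp only [evenCell]
  omega

theorem not_adj_oddCell (p q : ℤ × ℤ) : ¬ X.Adj (oddCell p) (oddCell q) := by
  rw [adj_iff]
  simp only [oddCell]
  omega

/-- The set of vertices with even cells `S` and odd cells `T`. -/
def cells (S T : Finset (ℤ × ℤ)) : Finset (ℤ × ℤ) := S.image evenCell ∪ T.image oddCell

theorem evenCell_mem_cells {S T : Finset (ℤ × ℤ)} {p : ℤ × ℤ} :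
    evenCell p ∈ cells S T ↔ p ∈ S := by
  simp only [cells, Finset.mem_union, Finset.mem_image]
  constructor
  · rintro (⟨q, hq, h⟩ | ⟨q, -, h⟩)
    · exact evenCell_injective h ▸ hq
    · exact absurd h.symm (evenCell_ne_oddCell _ _)
  · exact fun h => Or.inl ⟨p, h, rfl⟩

theorem oddCell_mem_cells {S T : Finset (ℤ × ℤ)} {p : ℤ × ℤ} :
    oddCell p ∈ cells S T ↔ p ∈ T := by
  simp only [cells, Finset.mem_union, Finset.mem_image]
  constructor
  · rintro (⟨q, -, h⟩ | ⟨q, hq, h⟩)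
    · exact absurd h (evenCell_ne_oddCell _ _)
    · exact oddCell_injective h ▸ hq
  · exact fun h => Or.inr ⟨p, h, rfl⟩

theorem card_cells (S T : Finset (ℤ × ℤ)) : (cells S T).card = S.card + T.card := by
  rw [cells, Finset.card_union_of_disjoint, Finset.card_image_of_injective _ evenCell_injective,
    Finset.card_image_of_injective _ oddCell_injective]
  simp only [Finset.disjoint_left, Finset.mem_image]
  rintro _ ⟨p, -, rfl⟩ ⟨q, -, h⟩
  exact evenCell_ne_oddCell _ _ h.symm

theorem exists_cells (A : Finset (ℤ × ℤ)) : ∃ S T, A = cells S T := by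
  refine ⟨A.preimage evenCell evenCell_injective.injOn,
    A.preimage oddCell oddCell_injective.injOn, ?_⟩
  ext p
  rcases exists_cell p with ⟨i, j, rfl⟩ | ⟨i, j, rfl⟩
  · rw [evenCell_mem_cells, Finset.mem_preimage]
  · rw [oddCell_mem_cells, Finset.mem_preimage]

/-- The sumset of `S` with `{-1, 0} × {-1, 0}`. -/
def thickenNeg (S : Finset (ℤ × ℤ)) : Finset (ℤ × ℤ) :=
  (thicken S).image fun p => (p.1 - 1, p.2 - 1)

theorem card_thickenNeg (S : Finset (ℤ × ℤ)) : (thickenNeg S).card = (thicken S).card := by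
  refine Finset.card_image_of_injective _ ?_
  rintro ⟨a, b⟩ ⟨c, d⟩ h
  simpa using h

theorem mem_thickenNeg {S : Finset (ℤ × ℤ)} {i j : ℤ} :
    (i, j) ∈ thickenNeg S ↔
      ((i + 1, j + 1) ∈ S ∨ (i, j + 1) ∈ S) ∨ ((i + 1, j) ∈ S ∨ (i, j) ∈ S) := by
  have : (i, j) ∈ thickenNeg S ↔ (i + 1, j + 1) ∈ thicken S := by
    simp only [thickenNeg, Finset.mem_image, Prod.mk.injEq, Prod.exists]
    constructor
    · rintro ⟨a, b, h, rfl, rfl⟩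
      simpa using h
    · exact fun h => ⟨_, _, h, by simp⟩
  rw [this, mem_thicken]
  simp

theorem vertexBoundary_cells (S T : Finset (ℤ × ℤ)) :
    vertexBoundary X (cells S T : Set (ℤ × ℤ)) =
      cells (thicken T \ S) (thickenNeg S \ T) := by
  ext p
  rcases exists_cell p with ⟨i, j, rfl⟩ | ⟨i, j, rfl⟩
  · rw [Finset.mem_coe, evenCell_mem_cells, Finset.mem_sdiff, mem_thicken]
    simp only [vertexBoundary, Set.mem_ofPred_eq, Finset.mem_coe, evenCell_mem_cells]
    rw [and_comm]
    refine and_congr_left fun _ => ⟨?_, ?_⟩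
    · rintro ⟨q, hq, hadj⟩
      rcases exists_cell q with ⟨k, l, rfl⟩ | ⟨k, l, rfl⟩
      · exact absurd hadj (not_adj_evenCell _ _)
      · rw [oddCell_mem_cells] at hq
        obtain ⟨rfl | rfl, rfl | rfl⟩ := adj_evenCell_oddCell.1 hadj <;> tauto
    · rintro ((h | h) | (h | h)) <;>
        exact ⟨_, oddCell_mem_cells.2 h, adj_evenCell_oddCell.2 (by omega)⟩
  · rw [Finset.mem_coe, oddCell_mem_cells, Finset.mem_sdiff, mem_thickenNeg]
    simp only [vertexBoundary, Set.mem_ofPred_eq, Finset.mem_coe, oddCell_mem_cells]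
    rw [and_comm]
    refine and_congr_left fun _ => ⟨?_, ?_⟩
    · rintro ⟨q, hq, hadj⟩
      rcases exists_cell q with ⟨k, l, rfl⟩ | ⟨k, l, rfl⟩
      · rw [evenCell_mem_cells] at hq
        have h := adj_evenCell_oddCell.1 hadj.symm
        obtain ⟨rfl | rfl, rfl | rfl⟩ : (k = i ∨ k = i + 1) ∧ (l = j ∨ l = j + 1) := by omega
        all_goals tauto
      · exact absurd hadj (not_adj_oddCell _ _)
    · rintro ((h | h) | (h | h)) <;>
        exact ⟨_, evenCell_mem_cells.2 h, (adj_evenCell_oddCell.2 (by omega)).symm⟩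

/-- The size of the vertex boundary of `cells S T`. -/
def boundaryCard (S T : Finset (ℤ × ℤ)) : ℕ :=
  (thicken T \ S).card + (thickenNeg S \ T).card

theorem encard_vertexBoundary_cells (S T : Finset (ℤ × ℤ)) :
    (vertexBoundary X (cells S T : Set (ℤ × ℤ))).encard = boundaryCard S T := by
  rw [vertexBoundary_cells, Set.encard_coe_eq_coe_finsetCard, card_cells, boundaryCard]

/-! ### Comparison of minimal sets with boxes -/

/-- Erase a point `p` of maximal first coordinate. Its right neighbour has no other neighbour in `B`
and leaves the boundary, while only `p` can enter. Hence minimal sets may also be compared with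
larger sets. -/
theorem exists_erase_boundary_le {B : Finset (ℤ × ℤ)} (hB : B.Nonempty) :
    ∃ p ∈ B, (vertexBoundary X (B.erase p : Set (ℤ × ℤ))).encard ≤
      (vertexBoundary X (B : Set (ℤ × ℤ))).encard := by
  obtain ⟨p, hp, hmax⟩ := B.exists_max_image Prod.fst hB
  refine ⟨p, hp, ?_⟩
  have hq : (p.1 + 1, p.2) ∈ vertexBoundary X (B : Set (ℤ × ℤ)) := by
    refine ⟨fun h => ?_, p, hp, adj_iff.2 (by simp)⟩
    have := hmax _ h
    simp at this
  have hsub : vertexBoundary X (B.erase p : Set (ℤ × ℤ)) ⊆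
      insert p (vertexBoundary X (B : Set (ℤ × ℤ)) \ {(p.1 + 1, p.2)}) := by
    rintro u ⟨hu, v, hv, huv⟩
    simp only [Finset.mem_coe, Finset.mem_erase, not_and_or, not_not] at hu hv
    rcases hu with rfl | hu
    · exact Set.mem_insert _ _
    · refine Set.mem_insert_of_mem _ ⟨⟨hu, v, hv.2, huv⟩, ?_⟩
      rintro rfl
      have h1 := hmax v hv.2
      have h2 : v = p := by
        rw [adj_iff] at huv
        ext
        · omega
        · omega
      exact hv.1 h2
  calc _ ≤ _ := Set.encard_le_encard hsub
    _ ≤ _ := Set.encard_insert_le _ _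
    _ = _ := Set.encard_sdiff_singleton_add_one hq

theorem exists_card_eq_boundary_le {m : ℕ} (B : Finset (ℤ × ℤ)) (hm : m ≤ B.card) :
    ∃ C : Finset (ℤ × ℤ), C.card = m ∧ (vertexBoundary X (C : Set (ℤ × ℤ))).encard ≤
      (vertexBoundary X (B : Set (ℤ × ℤ))).encard := by
  obtain ⟨d, hd⟩ := Nat.exists_eq_add_of_le hm
  induction d generalizing B with
  | zero => exact ⟨B, hd, le_rfl⟩
  | succ d ih =>
    obtain ⟨p, hp, hle⟩ := exists_erase_boundary_le (B := B) (Finset.card_pos.1 (by omega))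
    have hcard := Finset.card_erase_of_mem hp
    obtain ⟨C, hC, hC'⟩ := ih (B.erase p) (by omega) (by omega)
    exact ⟨C, hC, hC'.trans hle⟩

theorem boundaryCard_le_of_minimal {S T S' T' : Finset (ℤ × ℤ)}
    (h : IsMinimal X (cells S T : Set (ℤ × ℤ))) (hcard : S.card + T.card ≤ S'.card + T'.card) :
    boundaryCard S T ≤ boundaryCard S' T' := by
  obtain ⟨C, hC, hC'⟩ := exists_card_eq_boundary_le (cells S' T') (m := S.card + T.card)
    (by rwa [card_cells])
  have := (h.2 C (by simp only [Set.encard_coe_eq_coe_finsetCard, card_cells, hC])).trans hC'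
  rw [encard_vertexBoundary_cells, encard_vertexBoundary_cells] at this
  exact_mod_cast this

/-- Each class lies inside the bounding rectangle of the other's thickening, so the boundary is at
most (s'+1)(t'+1) - st + (s+1)(t+1) - s't'. -/
theorem exists_box (s t s' t' : ℕ) (hs : s' ≤ s) (hs' : s ≤ s' + 1) (ht : t' ≤ t)
    (ht' : t ≤ t' + 1) : ∃ S T : Finset (ℤ × ℤ), S.card + T.card = s * t + s' * t' ∧
      boundaryCard S T ≤ s + t + s' + t' + 2 := by
  let R : ℤ → ℕ → ℕ → Finset (ℤ × ℤ) := fun o a b =>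
    Finset.Ico o (o + a) ×ˢ Finset.Ico o (o + b)
  have hmem : ∀ o a b i j, (i, j) ∈ R o a b ↔ (o ≤ i ∧ i < o + a) ∧ (o ≤ j ∧ j < o + b) := by
    intros
    simp [R]
  have hcard : ∀ o a b, (R o a b).card = a * b := by
    intros
    simp [R]
  have key : ∀ {P Q E : Finset (ℤ × ℤ)}, P ⊆ E → Q ⊆ E → (P \ Q).card + Q.card ≤ E.card := by
    intro P Q E hP hQ
    rw [← Finset.card_sdiff_add_card_eq_card hQ]
    exact Nat.add_le_add_right (Finset.card_le_card (Finset.sdiff_subset_sdiff hP le_rfl)) _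
  refine ⟨R 0 s t, R 0 s' t', by rw [hcard, hcard], ?_⟩
  have h1 := key (P := thicken (R 0 s' t')) (Q := R 0 s t) (E := R 0 (s' + 1) (t' + 1))
    (by
      rintro ⟨i, j⟩ h
      rw [mem_thicken] at h
      simp only [hmem] at h ⊢
      push_cast
      omega)
    (by
      rintro ⟨i, j⟩ h
      simp only [hmem] at h ⊢
      push_cast
      omega)
  have h2 := key (P := thickenNeg (R 0 s t)) (Q := R 0 s' t') (E := R (-1) (s + 1) (t + 1))
    (by
      rintro ⟨i, j⟩ h
      rw [mem_thickenNeg] at h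
      simp only [hmem] at h ⊢
      push_cast
      omega)
    (by
      rintro ⟨i, j⟩ h
      simp only [hmem] at h ⊢
      push_cast
      omega)
  rw [hcard, hcard] at h1 h2
  simp only [boundaryCard]
  linarith

/-- The four side lengths sum to `k` and are as equal as possible. The `+ 1` is attained for odd
`k`. -/
theorem exists_balanced_box {k : ℕ} (hk : 2 ≤ k) : ∃ S T : Finset (ℤ × ℤ),
    k ^ 2 ≤ 8 * (S.card + T.card) + 1 ∧ boundaryCard S T ≤ k + 2 := by
  obtain ⟨m, hm⟩ : ∃ m, k = 4 * m ∨ k = 4 * m + 1 ∨ k = 4 * m + 2 ∨ k = 4 * m + 3 :=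
    ⟨k / 4, by omega⟩
  rcases hm with rfl | rfl | rfl | rfl
  · obtain ⟨S, T, h1, h2⟩ := exists_box m m m m (by omega) (by omega) (by omega) (by omega)
    exact ⟨S, T, by rw [h1]; nlinarith, by omega⟩
  · obtain ⟨S, T, h1, h2⟩ := exists_box (m + 1) m m m (by omega) (by omega) (by omega) (by omega)
    exact ⟨S, T, by rw [h1]; nlinarith, by omega⟩
  · obtain ⟨S, T, h1, h2⟩ :=
      exists_box (m + 1) (m + 1) m m (by omega) (by omega) (by omega) (by omega)
    exact ⟨S, T, by rw [h1]; nlinarith, by omega⟩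
  · obtain ⟨S, T, h1, h2⟩ :=
      exists_box (m + 1) (m + 1) (m + 1) m (by omega) (by omega) (by omega) (by omega)
    exact ⟨S, T, by rw [h1]; nlinarith, by omega⟩

/-- A minimal set is larger than every balanced box with a smaller boundary. -/
theorem sq_le_card_of_minimal {S T : Finset (ℤ × ℤ)}
    (h : IsMinimal X (cells S T : Set (ℤ × ℤ))) {k : ℕ} (hk : 2 ≤ k)
    (hkD : k + 3 ≤ boundaryCard S T) : k ^ 2 + 7 ≤ 8 * (S.card + T.card) := by
  obtain ⟨S', T', h1, h2⟩ := exists_balanced_box hk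
  by_contra hlt
  have := boundaryCard_le_of_minimal h (S' := S') (T' := T') (by omega)
  omega

/-! ### Arithmetic of minimal sets -/

theorem lineCount_ge_two {S : Finset (ℤ × ℤ)} (hS : S.Nonempty) : 2 ≤ lineCount S := by
  have h1 := (hS.image Prod.fst).card_pos
  have h2 := (hS.image Prod.snd).card_pos
  simp only [lineCount]
  omega

theorem card_le_image_mul_image (S : Finset (ℤ × ℤ)) :
    S.card ≤ (S.image Prod.fst).card * (S.image Prod.snd).card := by
  rw [← Finset.card_product]
  exact Finset.card_le_card Finset.subset_product

theorem four_mul_card_le (S : Finset (ℤ × ℤ)) : 4 * S.card ≤ lineCount S ^ 2 := by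
  have h := card_le_image_mul_image S
  simp only [lineCount]
  zify at h ⊢
  nlinarith [sq_nonneg (((S.image Prod.fst).card : ℤ) - (S.image Prod.snd).card)]

theorem le_boundaryCard (S T : Finset (ℤ × ℤ)) :
    (thicken S).card + (thicken T).card ≤ boundaryCard S T + S.card + T.card := by
  have h1 := Finset.card_sdiff_add_card_inter (thicken T) S
  have h2 := Finset.card_sdiff_add_card_inter (thickenNeg S) T
  have h3 := Finset.card_le_card (Finset.inter_subset_right (s₁ := thicken T) (s₂ := S))
  have h4 := Finset.card_le_card (Finset.inter_subset_right (s₁ := thickenNeg S) (s₂ := T))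
  rw [card_thickenNeg] at h2
  simp only [boundaryCard]
  omega

theorem card_thicken_left_le (S T : Finset (ℤ × ℤ)) :
    (thicken S).card ≤ boundaryCard S T + T.card := by
  have h2 := Finset.card_sdiff_add_card_inter (thickenNeg S) T
  have h4 := Finset.card_le_card (Finset.inter_subset_right (s₁ := thickenNeg S) (s₂ := T))
  rw [card_thickenNeg] at h2
  simp only [boundaryCard]
  omega

theorem card_thicken_right_le (S T : Finset (ℤ × ℤ)) :
    (thicken T).card ≤ boundaryCard S T + S.card := by
  have h1 := Finset.card_sdiff_add_card_inter (thicken T) S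
  have h3 := Finset.card_le_card (Finset.inter_subset_right (s₁ := thicken T) (s₂ := S))
  simp only [boundaryCard]
  omega

/-- The bound `le_boundaryCard` loses exactly the points of each class not covered by the thickening
of the other. -/
theorem subset_of_boundaryCard_le {S T : Finset (ℤ × ℤ)}
    (h : boundaryCard S T + S.card + T.card ≤ (thicken S).card + (thicken T).card) :
    S ⊆ thicken T ∧ T ⊆ thickenNeg S := by
  have h1 := Finset.card_sdiff_add_card_inter (thicken T) S
  have h2 := Finset.card_sdiff_add_card_inter (thickenNeg S) T
  have h3 := Finset.card_le_card (Finset.inter_subset_right (s₁ := thicken T) (s₂ := S))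
  have h4 := Finset.card_le_card (Finset.inter_subset_right (s₁ := thickenNeg S) (s₂ := T))
  rw [card_thickenNeg] at h2
  simp only [boundaryCard] at h
  constructor
  · rw [← Finset.inter_eq_right]
    exact Finset.eq_of_subset_of_card_le Finset.inter_subset_right (by omega)
  · rw [← Finset.inter_eq_right]
    exact Finset.eq_of_subset_of_card_le Finset.inter_subset_right (by omega)

/-- If |k - l| ≤ 2, then 8(a + b) ≤ (k + l)² + (k - l)² is too small. If k ≥ l + 3, `hab` bounds a
through b; if l ≥ k + 3, already 8(a + b) ≤ 16a ≤ 4k². -/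
theorem no_unbalanced_of_le {a b k l K : ℤ} (ha : 4 * a ≤ k ^ 2) (hb : 4 * b ≤ l ^ 2)
    (hk : 2 ≤ k) (hl : 2 ≤ l) (hK : k + l ≤ K) (hab : a + k ≤ b + K + 2) (hle : b ≤ a)
    (h : K ^ 2 + 7 ≤ 8 * (a + b)) : False := by
  rcases le_or_gt (l + 3) k with h1 | h1
  · nlinarith [mul_nonneg (show 0 ≤ K - (k + l) by omega) (show 0 ≤ l - 2 by omega),
      sq_nonneg (K - 2 * l - 3), mul_nonneg (show 0 ≤ k - l - 3 by omega) (show 0 ≤ l - 2 by omega)]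
  · rcases le_or_gt (k + 3) l with h2 | h2
    · nlinarith
    · nlinarith [mul_nonneg (show 0 ≤ k - l + 2 by omega) (show 0 ≤ l - k + 2 by omega)]

theorem no_unbalanced {a b k l K : ℤ} (ha : 4 * a ≤ k ^ 2) (hb : 4 * b ≤ l ^ 2)
    (hk : 2 ≤ k) (hl : 2 ≤ l) (hK : k + l ≤ K) (hab : a + k ≤ b + K + 2)
    (hba : b + l ≤ a + K + 2) (h : K ^ 2 + 7 ≤ 8 * (a + b)) : False := by
  rcases le_total b a with hle | hle
  · exact no_unbalanced_of_le ha hb hk hl hK hab hle h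
  · exact no_unbalanced_of_le hb ha hl hk (by omega) hba hle (by omega)

theorem no_split_of_le {a b k l : ℤ} (ha : 4 * a ≤ (k - 2) ^ 2 + 4) (hb : 4 * b ≤ (l - 2) ^ 2 + 4)
    (hk : 4 ≤ k) (hl : 4 ≤ l) (hab : a ≤ b + l + 1) (hle : l ≤ k)
    (h : (k + l - 1) ^ 2 + 7 ≤ 8 * (a + b)) : False := by
  rcases le_or_gt (l + 2) k with h1 | h1
  · nlinarith [mul_nonneg (show 0 ≤ k - l - 2 by omega) (show 0 ≤ l - 4 by omega)]
  · obtain rfl | rfl : k = l ∨ k = l + 1 := by omega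
    · nlinarith
    · nlinarith

theorem no_split {a b k l : ℤ} (ha : 4 * a ≤ (k - 2) ^ 2 + 4) (hb : 4 * b ≤ (l - 2) ^ 2 + 4)
    (hk : 4 ≤ k) (hl : 4 ≤ l) (hab : a ≤ b + l + 1) (hba : b ≤ a + k + 1)
    (h : (k + l - 1) ^ 2 + 7 ≤ 8 * (a + b)) : False := by
  rcases le_total l k with hle | hle
  · exact no_split_of_le ha hb hk hl hab hle h
  · exact no_split_of_le hb ha hl hk hba hle (by rw [add_comm l, add_comm b]; exact h)

theorem boundaryCard_of_minimal {S T : Finset (ℤ × ℤ)} (hS : S.Nonempty) (hT : T.Nonempty)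
    (h : IsMinimal X (cells S T : Set (ℤ × ℤ))) :
    boundaryCard S T = lineCount S + lineCount T + 2 := by
  have h1 := card_thicken hS
  have h2 := card_thicken hT
  have h3 := le_boundaryCard S T
  have h4 := card_thicken_left_le S T
  have h5 := card_thicken_right_le S T
  have hk := lineCount_ge_two hS
  have hl := lineCount_ge_two hT
  by_contra hne
  obtain ⟨K, hK⟩ := Nat.exists_eq_add_of_le (show 3 ≤ boundaryCard S T by omega)
  have h6 := sq_le_card_of_minimal h (k := K) (by omega) (by omega)
  refine no_unbalanced (a := S.card) (b := T.card) (k := lineCount S) (l := lineCount T) (K := K)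
    (mod_cast four_mul_card_le S) (mod_cast four_mul_card_le T) ?_ ?_ ?_ ?_ ?_ (mod_cast h6) <;>
    omega

/-- A single parity class is minimal only if it has at most two points, and then the thickening
bound is attained. -/
theorem card_le_two_of_single {S : Finset (ℤ × ℤ)} {D : ℕ}
    (hD : D = (thicken S).card) (hS : S.Nonempty)
    (h : ∀ k, 2 ≤ k → k + 3 ≤ D → k ^ 2 + 7 ≤ 8 * S.card) :
    S.card = 1 ∨ (S.card = 2 ∧ lineCount S = 3 ∧ (thicken S).card ≤ S.card + lineCount S + 1) := by
  have h1 := card_thicken hS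
  have h2 := four_mul_card_le S
  have hk := lineCount_ge_two hS
  have hpos := hS.card_pos
  by_contra hne
  push Not at hne
  obtain ⟨K, hK⟩ := Nat.exists_eq_add_of_le (show 3 ≤ D by omega)
  have h3 := h K (by omega) (by omega)
  have hS2 : 2 ≤ S.card := by omega
  have hl3 : 3 ≤ lineCount S := by nlinarith
  rcases eq_or_lt_of_le hS2 with h4 | h4
  · have hK3 : K ≤ 3 := by nlinarith
    have := hne.2 h4.symm
    omega
  -- With n ≥ 3 points, K ≥ n + 2, and (n + 2)² + 7 ≤ 8n is impossible.
  · have hl4 : 4 ≤ lineCount S := by nlinarith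
    have : S.card + 2 ≤ K := by omega
    zify at *
    nlinarith [sq_nonneg ((S.card : ℤ) - 2)]

/-! ### Linked pairs of parity classes -/

/-- Two orthogonally convex parity classes such that every point of each class has a neighbour in
the other class. -/
structure Linked (S T : ℤ → ℤ → Prop) : Prop where
  even : OrthoConvex S
  odd : OrthoConvex T
  cover_even : ∀ ⦃i j⦄, S i j → ∃ k l, T k l ∧ (k = i ∨ k = i - 1) ∧ (l = j ∨ l = j - 1)
  cover_odd : ∀ ⦃k l⦄, T k l → ∃ i j, S i j ∧ (k = i ∨ k = i - 1) ∧ (l = j ∨ l = j - 1)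

theorem linked_of_minimal {S T : Finset (ℤ × ℤ)} (hS : S.Nonempty) (hT : T.Nonempty)
    (h : IsMinimal X (cells S T : Set (ℤ × ℤ))) :
    Linked (fun i j => (i, j) ∈ S) (fun i j => (i, j) ∈ T) := by
  have h0 := boundaryCard_of_minimal hS hT h
  have h1 := card_thicken hS
  have h2 := card_thicken hT
  have h3 := le_boundaryCard S T
  obtain ⟨hST, hTS⟩ := subset_of_boundaryCard_le (S := S) (T := T) (by omega)
  refine ⟨orthoConvex_of_card_thicken (by omega), orthoConvex_of_card_thicken (by omega), ?_, ?_⟩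
  · intro i j hij
    rcases mem_thicken.1 (hST hij) with (h | h) | (h | h) <;> exact ⟨_, _, h, by simp, by simp⟩
  · intro k l hkl
    rcases mem_thickenNeg.1 (hTS hkl) with (h | h) | (h | h) <;> exact ⟨_, _, h, by simp, by simp⟩

theorem QuadrantConvex.snd_convex {S : ℤ → ℤ → Prop} (h : QuadrantConvex S) {i j j' m : ℤ}
    (hj : S i j) (hj' : S i j') (h1 : j ≤ m) (h2 : m ≤ j') : S i m :=
  h _ _ ⟨_, _, hj', le_rfl, h2⟩ ⟨_, _, hj, le_rfl, h1⟩ ⟨_, _, hj', le_rfl, h2⟩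
    ⟨_, _, hj, le_rfl, h1⟩

theorem OrthoConvex.swap {S : ℤ → ℤ → Prop} (h : OrthoConvex S) :
    OrthoConvex fun i j => S j i where
  quadrant := fun z w ⟨a, b, h1, h2, h3⟩ ⟨a', b', h1', h2', h3'⟩ ⟨c, d, g1, g2, g3⟩
    ⟨c', d', g1', g2', g3'⟩ => h.quadrant w z ⟨b, a, h1, h3, h2⟩ ⟨d, c, g1, g3, g2⟩
      ⟨b', a', h1', h3', h2'⟩ ⟨d', c', g1', g3', g2'⟩
  fst _ _ _ _ _ hi hi' h1 h2 := h.snd hi hi' h1 h2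
  snd _ _ _ _ _ hi hi' h1 h2 := h.fst hi hi' h1 h2

theorem OrthoConvex.neg {S : ℤ → ℤ → Prop} (h : OrthoConvex S) :
    OrthoConvex fun i j => S (-i) (-j) where
  quadrant := fun z w ⟨a, b, h1, h2, h3⟩ ⟨a', b', h1', h2', h3'⟩ ⟨c, d, g1, g2, g3⟩
    ⟨c', d', g1', g2', g3'⟩ => h.quadrant (-z) (-w) ⟨_, _, g1', by omega, by omega⟩
      ⟨_, _, g1, by omega, by omega⟩ ⟨_, _, h1', by omega, by omega⟩
      ⟨_, _, h1, by omega, by omega⟩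
  fst _ _ _ _ _ hi hi' h1 h2 :=
    (h.fst hi' hi (neg_le_neg h2) (neg_le_neg h1)).imp' Neg.neg fun l hl => by simpa using hl
  snd _ _ _ _ _ hi hi' h1 h2 :=
    (h.snd hi' hi (neg_le_neg h2) (neg_le_neg h1)).imp' Neg.neg fun l hl => by simpa using hl

namespace Linked

variable {S T : ℤ → ℤ → Prop}

theorem swap (h : Linked S T) : Linked (fun i j => S j i) (fun i j => T j i) where
  even := h.even.swap
  odd := h.odd.swap
  cover_even _ _ hs := by
    obtain ⟨k, l, h1, h2, h3⟩ := h.cover_even hs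
    exact ⟨l, k, h1, h3, h2⟩
  cover_odd _ _ hs := by
    obtain ⟨k, l, h1, h2, h3⟩ := h.cover_odd hs
    exact ⟨l, k, h1, h3, h2⟩

theorem exchange (h : Linked S T) :
    Linked (fun i j => T (-i) (-j)) (fun i j => S (-i) (-j)) where
  even := h.odd.neg
  odd := h.even.neg
  cover_even _ _ hs := by
    obtain ⟨k, l, h1, h2, h3⟩ := h.cover_odd hs
    exact ⟨-k, -l, by simpa using h1, by omega, by omega⟩
  cover_odd _ _ hs := by
    obtain ⟨k, l, h1, h2, h3⟩ := h.cover_even hs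
    exact ⟨-k, -l, by simpa using h1, by omega, by omega⟩

/-- The neighbours of the two cells show that row `j` of `T` is occupied. They lie in columns `i -
1` and `i`, so orthogonal convexity carries a point of that row to one of these columns. -/
theorem exists_common_neighbour (h : Linked S T) {i j : ℤ} (h1 : S i j) (h2 : S i (j + 1)) :
    T i j ∨ T (i - 1) j := by
  obtain ⟨k, l, hT, hk, hl⟩ := h.cover_even h1
  obtain ⟨k', l', hT', hk', hl'⟩ := h.cover_even h2
  obtain ⟨m, hm⟩ := h.odd.snd hT hT' (m := j) (by omega) (by omega)
  rcases le_or_gt i m with him | him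
  · exact Or.inl (h.odd.quadrant _ _ ⟨_, _, hm, him, le_rfl⟩ ⟨_, _, hm, him, le_rfl⟩
      ⟨_, _, hT', by omega, by omega⟩ ⟨_, _, hT, by omega, by omega⟩)
  · exact Or.inr (h.odd.quadrant _ _ ⟨_, _, hT', by omega, by omega⟩
      ⟨_, _, hT, by omega, by omega⟩ ⟨_, _, hm, by omega, le_rfl⟩ ⟨_, _, hm, by omega, le_rfl⟩)

/-- A colouring of the two classes that is constant along edges. -/
def Compatible (S T c d : ℤ → ℤ → Prop) : Prop :=
  ∀ ⦃i j k l⦄, S i j → T k l → (k = i ∨ k = i - 1) → (l = j ∨ l = j - 1) → (c i j ↔ d k l)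

variable {c d : ℤ → ℤ → Prop}

theorem Compatible.swap (h : Compatible S T c d) :
    Compatible (fun i j => S j i) (fun i j => T j i) (fun i j => c j i) (fun i j => d j i) :=
  fun _ _ _ _ h1 h2 h3 h4 => h h1 h2 h4 h3

theorem Compatible.exchange (h : Compatible S T c d) :
    Compatible (fun i j => T (-i) (-j)) (fun i j => S (-i) (-j)) (fun i j => d (-i) (-j))
      (fun i j => c (-i) (-j)) :=
  fun _ _ _ _ h1 h2 h3 h4 => (h h2 h1 (by omega) (by omega)).symm

theorem colour_iff_of_fst_eq (h : Linked S T) (hc : Compatible S T c d) {i j j' : ℤ}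
    (h1 : S i j) (h2 : S i j') : c i j ↔ c i j' := by
  wlog hle : j ≤ j' generalizing j j'
  · exact (this h2 h1 (le_of_not_ge hle)).symm
  induction j', hle using Int.leInduction with
  | base => rfl
  | succ n hn ih =>
    have hs : S i n := h.even.quadrant.snd_convex h1 h2 hn (by omega)
    rw [ih hs]
    rcases h.exists_common_neighbour hs h2 with ht | ht
    · rw [hc hs ht (by simp) (by simp), hc h2 ht (by simp) (by simp)]
    · rw [hc hs ht (by simp) (by simp), hc h2 ht (by simp) (by simp)]

theorem colour_iff_of_snd_eq (h : Linked S T) (hc : Compatible S T c d) {i i' j : ℤ}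
    (h1 : S i j) (h2 : S i' j) : c i j ↔ c i' j :=
  h.swap.colour_iff_of_fst_eq hc.swap h1 h2

/-- A point of `T` in a quadrant would bring a neighbour in `S` with it. Strict inequalities occur
because the odd cell `(k, l)` sits at `(k + 1/2, l + 1/2)` relative to the even cells. -/
theorem exists_quadrant (h : Linked S T) {z w : ℤ} (hz : ¬ S z w) :
    ((∀ i j, S i j → ¬ (z ≤ i ∧ w ≤ j)) ∧ ∀ i j, T i j → ¬ (z ≤ i ∧ w ≤ j)) ∨
    ((∀ i j, S i j → ¬ (z ≤ i ∧ j ≤ w)) ∧ ∀ i j, T i j → ¬ (z ≤ i ∧ j < w)) ∨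
    ((∀ i j, S i j → ¬ (i ≤ z ∧ w ≤ j)) ∧ ∀ i j, T i j → ¬ (i < z ∧ w ≤ j)) ∨
    ((∀ i j, S i j → ¬ (i ≤ z ∧ j ≤ w)) ∧ ∀ i j, T i j → ¬ (i < z ∧ j < w)) := by
  have key : ∀ {P : ℤ → ℤ → Prop} {Q : ℤ → ℤ → Prop},
      (∀ i j k l, Q k l → (k = i ∨ k = i - 1) → (l = j ∨ l = j - 1) → P i j) →
      (¬ ∃ i j, S i j ∧ P i j) →
      (∀ i j, S i j → ¬ P i j) ∧ ∀ i j, T i j → ¬ Q i j := by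
    intro P Q hPQ hno
    refine ⟨fun i j hs hp => hno ⟨i, j, hs, hp⟩, fun k l ht hq => ?_⟩
    obtain ⟨i, j, hs, hk, hl⟩ := h.cover_odd ht
    exact hno ⟨i, j, hs, hPQ i j k l hq hk hl⟩
  by_cases h1 : ∃ i j, S i j ∧ z ≤ i ∧ w ≤ j
  swap; · exact Or.inl (key (by omega) h1)
  by_cases h2 : ∃ i j, S i j ∧ z ≤ i ∧ j ≤ w
  swap; · exact Or.inr (Or.inl (key (by omega) h2))
  by_cases h3 : ∃ i j, S i j ∧ i ≤ z ∧ w ≤ j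
  swap; · exact Or.inr (Or.inr (Or.inl (key (by omega) h3)))
  by_cases h4 : ∃ i j, S i j ∧ i ≤ z ∧ j ≤ w
  swap; · exact Or.inr (Or.inr (Or.inr (key (by omega) h4)))
  exact absurd (h.even.quadrant z w h1 h2 h3 h4) hz

end Linked

/-- The colour classes share no row or column, so their line counts, each at least 2, add up to at
most that of `S`. The sum of their squares is largest at the split 2 and `lineCount S - 2`. -/
theorem card_le_of_split {S : Finset (ℤ × ℤ)} {c : ℤ × ℤ → Prop}
    (hfst : ∀ p ∈ S, ∀ q ∈ S, p.1 = q.1 → (c p ↔ c q))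
    (hsnd : ∀ p ∈ S, ∀ q ∈ S, p.2 = q.2 → (c p ↔ c q))
    (hc : ∃ p ∈ S, c p) (hnc : ∃ p ∈ S, ¬ c p) :
    4 ≤ lineCount S ∧ 4 * (S.card : ℤ) ≤ (lineCount S - 2) ^ 2 + 4 := by
  classical
  have hsplit : ∀ f : ℤ × ℤ → ℤ, (∀ p ∈ S, ∀ q ∈ S, f p = f q → (c p ↔ c q)) →
      ((S.filter c).image f).card + ((S.filter fun p => ¬ c p).image f).card ≤
        (S.image f).card := by
    intro f hf
    rw [← Finset.card_union_of_disjoint]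
    · exact Finset.card_le_card (Finset.union_subset
        (Finset.image_subset_image (Finset.filter_subset _ _))
        (Finset.image_subset_image (Finset.filter_subset _ _)))
    · simp only [Finset.disjoint_left, Finset.mem_image, Finset.mem_filter]
      rintro _ ⟨p, ⟨hp, hcp⟩, rfl⟩ ⟨q, ⟨hq, hcq⟩, heq⟩
      exact hcq ((hf q hq p hp heq).2 hcp)
  have h1 := hsplit Prod.fst hfst
  have h2 := hsplit Prod.snd hsnd
  have h3 := Finset.card_filter_add_card_filter_not (s := S) c
  have hne : (S.filter c).Nonempty := by simpa [Finset.Nonempty, Finset.mem_filter] using hc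
  have hne' : (S.filter fun p => ¬ c p).Nonempty := by
    simpa [Finset.Nonempty, Finset.mem_filter] using hnc
  have h4 := four_mul_card_le (S.filter c)
  have h5 := four_mul_card_le (S.filter fun p => ¬ c p)
  have h6 := lineCount_ge_two hne
  have h7 := lineCount_ge_two hne'
  have h8 : lineCount (S.filter c) + lineCount (S.filter fun p => ¬ c p) ≤ lineCount S := by
    simp only [lineCount]
    omega
  refine ⟨by omega, ?_⟩
  zify at h3 h4 h5 h6 h7 h8
  nlinarith [mul_nonneg (sub_nonneg.2 h6) (sub_nonneg.2 h7)]

/-! ### Automorphisms and cones -/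

/-- The translation moving `z` to the origin. -/
def translateIso (z : ℤ × ℤ) : X ≃g X where
  toFun p := (p.1 - z.1, p.2 - z.2)
  invFun p := (p.1 + z.1, p.2 + z.2)
  left_inv p := by simp
  right_inv p := by simp
  map_rel_iff' {u v} := by
    simp only [Equiv.coe_fn_mk, adj_iff]
    omega

/-- The reflection exchanging the coordinates. -/
def swapIso : X ≃g X where
  toFun p := (p.2, p.1)
  invFun p := (p.2, p.1)
  left_inv p := by simp
  right_inv p := by simp
  map_rel_iff' {u v} := by
    simp only [Equiv.coe_fn_mk, adj_iff]
    omega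

/-- The reflection changing the sign of the first coordinate. -/
def reflectIso : X ≃g X where
  toFun p := (-p.1, p.2)
  invFun p := (-p.1, p.2)
  left_inv p := by simp
  right_inv p := by simp
  map_rel_iff' {u v} := by
    simp only [Equiv.coe_fn_mk, adj_iff]
    omega

/-- The point reflection. -/
def negIso : X ≃g X where
  toFun p := (-p.1, -p.2)
  invFun p := (-p.1, -p.2)
  left_inv p := by simp
  right_inv p := by simp
  map_rel_iff' {u v} := by
    simp only [Equiv.coe_fn_mk, adj_iff]
    omega

theorem isUnionOfCones_compl {A : Set (ℤ × ℤ)}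
    (h : ∀ z ∉ A, ∃ φ : X ≃g X, φ z ∈ standardCone ∧ ∀ p ∈ A, φ p ∉ standardCone) :
    IsUnionOfCones Aᶜ := by
  refine ⟨{C | IsCone C ∧ C ⊆ Aᶜ}, fun C hC => hC.1, ?_⟩
  refine Set.Subset.antisymm (fun z hz => ?_) (Set.sUnion_subset fun C hC => hC.2)
  obtain ⟨φ, hφ, hA⟩ := h z hz
  exact ⟨φ ⁻¹' standardCone, ⟨⟨φ, Set.image_preimage_eq _ φ.surjective⟩,
    fun p hp hpA => hA p hpA hp⟩, hφ⟩

/-- One of the four closed quadrants at `z`, in diagonal coordinates, is disjoint from `A`. -/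
def MissesQuadrant (A : Set (ℤ × ℤ)) (z : ℤ × ℤ) : Prop :=
  (∀ p ∈ A, ¬ (z.2 - z.1 ≤ p.2 - p.1 ∧ z.1 + z.2 ≤ p.1 + p.2)) ∨
  (∀ p ∈ A, ¬ (z.2 - z.1 ≤ p.2 - p.1 ∧ p.1 + p.2 ≤ z.1 + z.2)) ∨
  (∀ p ∈ A, ¬ (p.2 - p.1 ≤ z.2 - z.1 ∧ z.1 + z.2 ≤ p.1 + p.2)) ∨
  (∀ p ∈ A, ¬ (p.2 - p.1 ≤ z.2 - z.1 ∧ p.1 + p.2 ≤ z.1 + z.2))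

theorem isUnionOfCones_of_missesQuadrant {A : Set (ℤ × ℤ)}
    (h : ∀ z ∉ A, MissesQuadrant A z) : IsUnionOfCones Aᶜ := by
  have key : ∀ p : ℤ × ℤ, p ∈ standardCone ↔ 0 ≤ p.2 - p.1 ∧ 0 ≤ p.2 + p.1 := fun p => Iff.rfl
  refine isUnionOfCones_compl fun z hz => ?_
  rcases h z hz with h | h | h | h
  · refine ⟨translateIso z, by simp [key, translateIso], fun p hp hc => h p hp ?_⟩
    simp only [key, translateIso, RelIso.coe_fn_mk, Equiv.coe_fn_mk] at hc
    omega
  · refine ⟨((translateIso z).trans swapIso).trans negIso,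
      by simp [key, translateIso, swapIso, negIso], fun p hp hc => h p hp ?_⟩
    simp only [key, translateIso, swapIso, negIso, RelIso.trans_apply, RelIso.coe_fn_mk,
      Equiv.coe_fn_mk] at hc
    omega
  · refine ⟨(translateIso z).trans swapIso,
      by simp [key, translateIso, swapIso], fun p hp hc => h p hp ?_⟩
    simp only [key, translateIso, swapIso, RelIso.trans_apply, RelIso.coe_fn_mk,
      Equiv.coe_fn_mk] at hc
    omega
  · refine ⟨(translateIso z).trans negIso,
      by simp [key, translateIso, negIso], fun p hp hc => h p hp ?_⟩
    simp only [key, translateIso, negIso, RelIso.trans_apply, RelIso.coe_fn_mk,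
      Equiv.coe_fn_mk] at hc
    omega

theorem forall_cells {S T : Finset (ℤ × ℤ)} {P : ℤ × ℤ → Prop}
    (hS : ∀ i j, (i, j) ∈ S → P (evenCell (i, j))) (hT : ∀ i j, (i, j) ∈ T → P (oddCell (i, j))) :
    ∀ p ∈ (cells S T : Set (ℤ × ℤ)), P p := by
  intro p hp
  rcases exists_cell p with ⟨i, j, rfl⟩ | ⟨i, j, rfl⟩
  · exact hS i j (evenCell_mem_cells.1 hp)
  · exact hT i j (oddCell_mem_cells.1 hp)

theorem missesQuadrant_of_linked {S T : Finset (ℤ × ℤ)}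
    (h : Linked (fun i j => (i, j) ∈ S) (fun i j => (i, j) ∈ T)) :
    ∀ z ∉ (cells S T : Set (ℤ × ℤ)), MissesQuadrant (cells S T) z := by
  intro z hz
  rcases exists_cell z with ⟨a, b, rfl⟩ | ⟨a, b, rfl⟩
  · rw [Finset.mem_coe, evenCell_mem_cells] at hz
    rcases h.exists_quadrant hz with ⟨h1, h2⟩ | ⟨h1, h2⟩ | ⟨h1, h2⟩ | ⟨h1, h2⟩
    · refine Or.inl (forall_cells (fun i j hij => ?_) fun i j hij => ?_)
      · have := h1 i j hij
        simp only [evenCell]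
        omega
      · have := h2 i j hij
        simp only [evenCell, oddCell]
        omega
    · refine Or.inr (Or.inl (forall_cells (fun i j hij => ?_) fun i j hij => ?_))
      · have := h1 i j hij
        simp only [evenCell]
        omega
      · have := h2 i j hij
        simp only [evenCell, oddCell]
        omega
    · refine Or.inr (Or.inr (Or.inl (forall_cells (fun i j hij => ?_) fun i j hij => ?_)))
      · have := h1 i j hij
        simp only [evenCell]
        omega
      · have := h2 i j hij
        simp only [evenCell, oddCell]
        omega
    · refine Or.inr (Or.inr (Or.inr (forall_cells (fun i j hij => ?_) fun i j hij => ?_)))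
      · have := h1 i j hij
        simp only [evenCell]
        omega
      · have := h2 i j hij
        simp only [evenCell, oddCell]
        omega
  · rw [Finset.mem_coe, oddCell_mem_cells] at hz
    -- A point reflection exchanges the parity classes and reduces this case to an even vertex, with
    -- every quadrant replaced by its opposite.
    have flip : ∀ {U : Finset (ℤ × ℤ)} {P : ℤ → ℤ → Prop},
        (∀ i j, (-i, -j) ∈ U → ¬ P i j) → ∀ i j, (i, j) ∈ U → ¬ P (-i) (-j) :=
      fun h i j hij => h (-i) (-j) (by simpa using hij)
    rcases h.exchange.exists_quadrant (z := -a) (w := -b) (by simpa using hz) with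
      ⟨h1, h2⟩ | ⟨h1, h2⟩ | ⟨h1, h2⟩ | ⟨h1, h2⟩
    · refine Or.inr (Or.inr (Or.inr (forall_cells (fun i j hij => ?_) fun i j hij => ?_)))
      · have := flip h2 i j hij
        simp only [evenCell, oddCell]
        omega
      · have := flip h1 i j hij
        simp only [oddCell]
        omega
    · refine Or.inr (Or.inr (Or.inl (forall_cells (fun i j hij => ?_) fun i j hij => ?_)))
      · have := flip h2 i j hij
        simp only [evenCell, oddCell]
        omega
      · have := flip h1 i j hij
        simp only [oddCell]
        omega
    · refine Or.inr (Or.inl (forall_cells (fun i j hij => ?_) fun i j hij => ?_))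
      · have := flip h2 i j hij
        simp only [evenCell, oddCell]
        omega
      · have := flip h1 i j hij
        simp only [oddCell]
        omega
    · refine Or.inl (forall_cells (fun i j hij => ?_) fun i j hij => ?_)
      · have := flip h2 i j hij
        simp only [evenCell, oddCell]
        omega
      · have := flip h1 i j hij
        simp only [oddCell]
        omega

/-! ### Connectedness -/

theorem isConnectedSet_of_linked {S T : Finset (ℤ × ℤ)} (hS : S.Nonempty) (hT : T.Nonempty)
    (h : IsMinimal X (cells S T : Set (ℤ × ℤ))) :
    IsConnectedSet X (cells S T : Set (ℤ × ℤ)) := by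
  have hL := linked_of_minimal hS hT h
  have hD := boundaryCard_of_minimal hS hT h
  intro u v
  by_contra huv
  -- The colour marks the component of `u`.
  let c : ℤ × ℤ → Prop := fun p => ∃ hp : p ∈ (cells S T : Set (ℤ × ℤ)),
    (X.induce (cells S T : Set (ℤ × ℤ))).Reachable u ⟨p, hp⟩
  have hadj : ∀ p ∈ (cells S T : Set (ℤ × ℤ)), ∀ q ∈ (cells S T : Set (ℤ × ℤ)), X.Adj p q →
      (c p → c q) := by
    rintro p hp q hq hpq ⟨hp', hr⟩
    refine ⟨hq, hr.trans (SimpleGraph.Adj.reachable ?_)⟩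
    exact hpq
  have hcompat : Linked.Compatible (fun i j => (i, j) ∈ S) (fun i j => (i, j) ∈ T)
      (fun i j => c (evenCell (i, j))) (fun i j => c (oddCell (i, j))) := by
    intro i j k l hs ht hk hl
    have ha : X.Adj (evenCell (i, j)) (oddCell (k, l)) := adj_evenCell_oddCell.2 ⟨hk, hl⟩
    have hs' := evenCell_mem_cells (T := T).2 hs
    have ht' := oddCell_mem_cells (S := S).2 ht
    exact ⟨hadj _ hs' _ ht' ha, hadj _ ht' _ hs' ha.symm⟩
  -- Since every vertex has a neighbour in the other class, both colours occur in both classes, and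
  -- each class splits.
  have hboth : ∀ p ∈ (cells S T : Set (ℤ × ℤ)),
      (∃ q ∈ S, c (evenCell q) ↔ c p) ∧ ∃ q ∈ T, c (oddCell q) ↔ c p := by
    refine forall_cells (fun i j hs => ⟨⟨_, hs, Iff.rfl⟩, ?_⟩) fun k l ht => ⟨?_, ⟨_, ht, Iff.rfl⟩⟩
    · obtain ⟨k, l, ht, hk, hl⟩ := hL.cover_even hs
      exact ⟨_, ht, (hcompat hs ht hk hl).symm⟩
    · obtain ⟨i, j, hs, hk, hl⟩ := hL.cover_odd ht
      exact ⟨_, hs, hcompat hs ht hk hl⟩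
  have hcu : c u := ⟨u.2, SimpleGraph.Reachable.refl _⟩
  have hcv : ¬ c v := fun ⟨_, hr⟩ => huv hr
  obtain ⟨⟨p, hp, hpu⟩, q, hq, hqu⟩ := hboth u u.2
  obtain ⟨⟨p', hp', hpv⟩, q', hq', hqv⟩ := hboth v v.2
  have hSsplit := card_le_of_split (S := S) (c := fun p => c (evenCell p))
    (by
      rintro ⟨i, j⟩ hs ⟨i', j'⟩ hs' (rfl : i = i')
      exact hL.colour_iff_of_fst_eq hcompat hs hs')
    (by
      rintro ⟨i, j⟩ hs ⟨i', j'⟩ hs' (rfl : j = j')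
      exact hL.colour_iff_of_snd_eq hcompat hs hs')
    ⟨p, hp, hpu.2 hcu⟩ ⟨p', hp', fun h => hcv (hpv.1 h)⟩
  have hTsplit := card_le_of_split (S := T) (c := fun p => c (oddCell p))
    (by
      rintro ⟨i, j⟩ hs ⟨i', j'⟩ hs' (rfl : i = i')
      simpa using hL.exchange.colour_iff_of_fst_eq hcompat.exchange (i := -i) (j := -j)
        (j' := -j') (by simpa using hs) (by simpa using hs'))
    (by
      rintro ⟨i, j⟩ hs ⟨i', j'⟩ hs' (rfl : j = j')
      simpa using hL.exchange.colour_iff_of_snd_eq hcompat.exchange (i := -i) (i' := -i')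
        (j := -j) (by simpa using hs) (by simpa using hs'))
    ⟨q, hq, hqu.2 hcu⟩ ⟨q', hq', fun h => hcv (hqv.1 h)⟩
  have h1 := card_thicken hS
  have h2 := card_thicken hT
  have h4 := card_thicken_left_le S T
  have h5 := card_thicken_right_le S T
  obtain ⟨K, hK⟩ := Nat.exists_eq_add_of_le (show 3 ≤ boundaryCard S T by omega)
  have h6 := sq_le_card_of_minimal h (k := K) (by omega) (by omega)
  have hK' : (K : ℤ) = lineCount S + lineCount T - 1 := by omega
  refine no_split hSsplit.2 hTsplit.2 (mod_cast hSsplit.1) (mod_cast hTsplit.1) (by omega)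
    (by omega) ?_
  rw [← hK']
  exact_mod_cast h6

/-! ### The disconnected minimal set -/

theorem box_zero_two : box 0 2 = {(0, 0), (1, 1)} := by
  ext ⟨x, y⟩
  simp only [box, Set.mem_ofPred_eq, Set.mem_insert_iff, Set.mem_singleton_iff, Prod.mk.injEq]
  push_cast
  omega

theorem not_isConnectedSet_of_congruent {A : Set (ℤ × ℤ)} (h : Congruent X A (box 0 2)) :
    ¬ IsConnectedSet X A := by
  obtain ⟨φ, hφ⟩ := h
  rw [box_zero_two] at hφ
  intro hconn
  have hmem : ∀ p ∈ A, φ p = (0, 0) ∨ φ p = (1, 1) := fun p hp => by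
    have : φ p ∈ φ '' A := ⟨p, hp, rfl⟩
    rwa [hφ] at this
  obtain ⟨p, hp, hp0⟩ : (0, 0) ∈ φ '' A := by rw [hφ]; simp
  obtain ⟨q, hq, hq1⟩ : (1, 1) ∈ φ '' A := by rw [hφ]; simp
  obtain ⟨w⟩ := hconn ⟨p, hp⟩ ⟨q, hq⟩
  cases w with
  | nil => simp [hp0] at hq1
  | @cons _ r _ hadj _ =>
    have h1 : X.Adj (φ p) (φ r) := φ.map_adj_iff.2 hadj
    rw [hp0, adj_iff] at h1
    rcases hmem r r.2 with h2 | h2 <;> simp [h2] at h1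

theorem congruent_box_of_diagonal (x : ℤ × ℤ) :
    Congruent X {x, (x.1 + 1, x.2 + 1)} (box 0 2) := by
  refine ⟨translateIso x, ?_⟩
  rw [box_zero_two, Set.image_pair]
  simp [translateIso]

theorem congruent_box_of_antidiagonal (x : ℤ × ℤ) :
    Congruent X {x, (x.1 - 1, x.2 + 1)} (box 0 2) := by
  refine ⟨(translateIso x).trans reflectIso, ?_⟩
  rw [box_zero_two, Set.image_pair]
  simp [translateIso, reflectIso]

/-- A set consisting of one point or of two points adjacent along a diagonal. -/
def IsSmall (A : Set (ℤ × ℤ)) : Prop :=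
  ∃ x, A = {x} ∨ A = {x, (x.1 + 1, x.2 + 1)} ∨ A = {x, (x.1 - 1, x.2 + 1)}

theorem IsSmall.missesQuadrant {A : Set (ℤ × ℤ)} (h : IsSmall A) :
    ∀ z ∉ A, MissesQuadrant A z := by
  rintro ⟨a, b⟩ hz
  obtain ⟨⟨x, y⟩, rfl | rfl | rfl⟩ := h <;>
    simp only [Set.mem_insert_iff, Set.mem_singleton_iff, Prod.mk.injEq] at hz <;>
    simp only [MissesQuadrant, Set.mem_insert_iff, Set.mem_singleton_iff, forall_eq_or_imp,
      forall_eq] <;>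
    omega

theorem IsSmall.isConnectedSet {A : Set (ℤ × ℤ)} (h : IsSmall A)
    (hA : ¬ Congruent X A (box 0 2)) : IsConnectedSet X A := by
  obtain ⟨x, rfl | rfl | rfl⟩ := h
  · rintro ⟨u, rfl⟩ ⟨v, rfl⟩
    exact SimpleGraph.Reachable.refl _
  · exact absurd (congruent_box_of_diagonal x) hA
  · exact absurd (congruent_box_of_antidiagonal x) hA

theorem eq_pair_of_tight {S : Finset (ℤ × ℤ)} (h2 : S.card = 2) (h3 : lineCount S = 3)
    (h : (thicken S).card ≤ S.card + lineCount S + 1) :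
    ∃ i j, S = {(i, j), (i, j + 1)} ∨ S = {(i, j), (i + 1, j)} := by
  have hO := (orthoConvex_of_card_thicken h).quadrant
  have hO' := (orthoConvex_of_card_thicken h).swap.quadrant
  obtain ⟨⟨a, b⟩, ⟨c, d⟩, hne, rfl⟩ := Finset.card_eq_two.1 h2
  have hp : (a, b) ∈ ({(a, b), (c, d)} : Finset (ℤ × ℤ)) := by simp
  have hq : (c, d) ∈ ({(a, b), (c, d)} : Finset (ℤ × ℤ)) := by simp
  -- Two points differing in both coordinates would have line count 4.
  have hac : a = c ∨ b = d := by
    by_contra! hcon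
    simp [lineCount, Finset.image_insert, Finset.card_pair hcon.1, Finset.card_pair hcon.2] at h3
  rcases hac with rfl | rfl
  · have hbd : b ≠ d := fun hbd => hne (by rw [hbd])
    rcases hbd.lt_or_gt with hlt | hlt
    · have := hO.snd_convex hp hq (m := b + 1) (by omega) hlt
      simp only [Finset.mem_insert, Finset.mem_singleton, Prod.mk.injEq] at this
      exact ⟨a, b, Or.inl (by rw [show d = b + 1 by omega])⟩
    · have := hO.snd_convex hq hp (m := d + 1) (by omega) hlt
      simp only [Finset.mem_insert, Finset.mem_singleton, Prod.mk.injEq] at this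
      exact ⟨a, d, Or.inl (by rw [show b = d + 1 by omega, Finset.pair_comm])⟩
  · have hac : a ≠ c := fun hac => hne (by rw [hac])
    rcases hac.lt_or_gt with hlt | hlt
    · have := hO'.snd_convex hp hq (m := a + 1) (by omega) hlt
      simp only [Finset.mem_insert, Finset.mem_singleton, Prod.mk.injEq] at this
      exact ⟨a, b, Or.inr (by rw [show c = a + 1 by omega])⟩
    · have := hO'.snd_convex hq hp (m := c + 1) (by omega) hlt
      simp only [Finset.mem_insert, Finset.mem_singleton, Prod.mk.injEq] at this
      exact ⟨c, b, Or.inr (by rw [show a = c + 1 by omega, Finset.pair_comm])⟩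

theorem isSmall_of_single {S : Finset (ℤ × ℤ)} {D : ℕ} (hD : D = (thicken S).card)
    (hS : S.Nonempty) (h : ∀ k, 2 ≤ k → k + 3 ≤ D → k ^ 2 + 7 ≤ 8 * S.card) :
    IsSmall (evenCell '' S) ∧ IsSmall (oddCell '' S) := by
  rcases card_le_two_of_single hD hS h with h1 | ⟨h1, h2, h3⟩
  · obtain ⟨p, rfl⟩ := Finset.card_eq_one.1 h1
    exact ⟨⟨evenCell p, Or.inl (by simp)⟩, ⟨oddCell p, Or.inl (by simp)⟩⟩
  · obtain ⟨i, j, rfl | rfl⟩ := eq_pair_of_tight h1 h2 h3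
    · refine ⟨⟨evenCell (i, j), Or.inr (Or.inl ?_)⟩, ⟨oddCell (i, j), Or.inr (Or.inl ?_)⟩⟩
      · rw [Finset.coe_pair, Set.image_pair]
        congr 2
        simp only [evenCell, Prod.mk.injEq]
        omega
      · rw [Finset.coe_pair, Set.image_pair]
        congr 2
        simp only [oddCell, Prod.mk.injEq]
        omega
    · refine ⟨⟨evenCell (i, j), Or.inr (Or.inr ?_)⟩, ⟨oddCell (i, j), Or.inr (Or.inr ?_)⟩⟩
      · rw [Finset.coe_pair, Set.image_pair]
        congr 2
        simp only [evenCell, Prod.mk.injEq]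
        omega
      · rw [Finset.coe_pair, Set.image_pair]
        congr 2
        simp only [oddCell, Prod.mk.injEq]
        omega

theorem isSmall_of_odd_empty {S : Finset (ℤ × ℤ)} (hS : S.Nonempty)
    (h : IsMinimal X (cells S ∅ : Set (ℤ × ℤ))) : IsSmall (cells S ∅ : Set (ℤ × ℤ)) := by
  have hD : boundaryCard S ∅ = (thicken S).card := by
    rw [boundaryCard, Finset.sdiff_empty, card_thickenNeg]
    simp [thicken, thickenUp, thickenRight]
  have := (isSmall_of_single hD hS fun k hk hkD => by
    simpa using sq_le_card_of_minimal h hk hkD).1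
  simpa [cells] using this

theorem isSmall_of_even_empty {T : Finset (ℤ × ℤ)} (hT : T.Nonempty)
    (h : IsMinimal X (cells ∅ T : Set (ℤ × ℤ))) : IsSmall (cells ∅ T : Set (ℤ × ℤ)) := by
  have hD : boundaryCard ∅ T = (thicken T).card := by
    rw [boundaryCard, Finset.sdiff_empty]
    simp [thickenNeg, thicken, thickenUp, thickenRight]
  have := (isSmall_of_single hD hT fun k hk hkD => by
    simpa using sq_le_card_of_minimal h hk hkD).2
  simpa [cells] using this

end L1Lattice

/-! ### The theorem, by which parity classes are empty -/

theorem mainTheorem7 (A : Set (ℤ × ℤ)) (hA : L1Lattice.IsMinimal L1Lattice.X A) :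
    (L1Lattice.IsConnectedSet L1Lattice.X A ↔
      ¬ L1Lattice.Congruent L1Lattice.X A (L1Lattice.box 0 2)) ∧
    L1Lattice.IsUnionOfCones Aᶜ := by
  open L1Lattice in
  suffices h : (¬ Congruent X A (box 0 2) → IsConnectedSet X A) ∧
      ∀ z ∉ A, MissesQuadrant A z from
    ⟨⟨fun hc hcong => not_isConnectedSet_of_congruent hcong hc, h.1⟩,
      isUnionOfCones_of_missesQuadrant h.2⟩
  obtain ⟨B, rfl⟩ := hA.1.exists_finset_coe
  obtain ⟨S, T, rfl⟩ := exists_cells B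
  rcases S.eq_empty_or_nonempty with rfl | hS <;> rcases T.eq_empty_or_nonempty with rfl | hT
  · have h0 : (cells ∅ ∅ : Set (ℤ × ℤ)) = ∅ := by simp [cells]
    rw [h0]
    exact ⟨fun _ u => u.2.elim, fun z _ => Or.inl fun p hp => hp.elim⟩
  · have h := isSmall_of_even_empty hT hA
    exact ⟨h.isConnectedSet, h.missesQuadrant⟩
  · have h := isSmall_of_odd_empty hS hA
    exact ⟨h.isConnectedSet, h.missesQuadrant⟩
  · exact ⟨fun _ => isConnectedSet_of_linked hS hT hA,
      missesQuadrant_of_linked (linked_of_minimal hS hT hA)⟩
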